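/- **Language.** There are individual variables $x_0,x_1,\dots$, countably many predicate symbols of each arity $n\ge 0$, justification variables $p_i$ and justification constants $c_i$ ($i\in\mathbb N$). Terms and formulas are $$t ::= p_i \mid c_i \mid (t\cdot t)\mid (t+t)\mid\; !t\mid \mathsf b(t)\mid \mathsf{gen}_x(t),\qquad \varphi ::= P(x_{i_1},\dots,x_{i_n})\mid\bot\mid(\varphi\to\varphi)\mid\forall x\,\varphi\mid t{:}_X\varphi ,$$ with $X$ a finite set of individual variables. Free variables are as usual, with $fv(t{:}_X\varphi)=X$: a free occurrence in $\varphi$ remains free in $t{:}_X\varphi$ iff its variable is in $X$. Substitution replaces free occurrences. A variable $y$ is free for $x$ in $\varphi$ if no replaced occurrence of $x$ falls under $\forall y$ and, for each subformula $t{:}_X\psi$ in which the free $x$ is replaced, $y\in fv(\psi)$ implies $y\in X$; similarly for simultaneous substitutions. $Xy$ stands for $X\cup\{y\}$ with $y\notin X$, and $t{:}\varphi$ for $t{:}_\emptyset\varphi$. **Axioms of $\mathsf{FOLPb}_0$.** - **A1** (classical logic): $\varphi\to(\psi\to\varphi)$; $(\varphi\to(\psi\to\chi))\to((\varphi\to\psi)\to(\varphi\to\chi))$;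 $((\varphi\to\bot)\to\bot)\to\varphi$; $\forall x\varphi\to\varphi(y/x)$ with $y$ free for $x$ in $\varphi$; $\forall x(\varphi\to\psi)\to(\varphi\to\forall x\psi)$ with $x\notin fv(\varphi)$. - **A2**: $t{:}_{Xy}\varphi\to t{:}_X\varphi$ with $y\notin fv(\varphi)$. **A3**: $t{:}_X\varphi\to t{:}_{Xy}\varphi$. - **B1**: $t{:}_X\varphi\to\varphi$. **B2**: $t{:}_X(\varphi\to\psi)\to(s{:}_X\varphi\to [t\cdot s]{:}_X\psi)$. **B3**: $t{:}_X\varphi\to[t+s]{:}_X\varphi$ and $s{:}_X\varphi\to[t+s]{:}_X\varphi$. **B4**: $t{:}_X\varphi\to\; !t{:}_X\,t{:}_X\varphi$. **B5**: $t{:}_X\varphi\to\mathsf{gen}_x(t){:}_X\forall x\varphi$ with $x\notin X$. **Bb**: $\forall y\,t{:}_{Xy}\varphi\to\mathsf b(t){:}_X\forall y\varphi$. A *constant specification* $\mathcal{CS}$ is a set of formulas $c{:}\psi$ with $c$ a justification constant and $\psi$ an axiom. It is *axiomatically appropriate* if for each axiom $\psi$ there is a constant $c$ with $c{:}\psi\in\mathcal{CS}$.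 It is *variant closed* if, whenever $\varphi$ and $\psi$ are axioms that are variable variants of each other (one arises from the other by a one-to-one, capture-free renaming of its free individual variables), $c{:}\varphi\in\mathcal{CS}$ iff $c{:}\psi\in\mathcal{CS}$ for every constant $c$. $\vdash_{\mathcal{CS}}\varphi$ means that $\varphi$ is derivable from the axioms and the members of $\mathcal{CS}$ by modus ponens and generalization ($\varphi\,/\,\forall x\varphi$). **Semantics.** For a set $\mathcal D\neq\emptyset$, a *$\mathcal D$-formula* is the result of putting members of $\mathcal D$ in place of free occurrences of variables in a formula; it is *closed* if no individual variable is free in it. A *Fitting model for $\mathsf{FOLPb}$* consists of a set $\mathcal W\ne\emptyset$ of worlds, a reflexive and transitive relation $\mathcal R$ on $\mathcal W$, a (constant) domain $\mathcal D\neq\emptyset$, an $n$-ary relation $\mathcal I(P,w)$ on $\mathcal D$ for each $n$-ary $P$ and each $w\in\mathcal W$, and sets $\mathcal E(t,\varphi)\subseteq\mathcal W$ for each term $t$ and $\mathcal D$-formula $\varphi$, such that always - $\mathcal E(t,\varphi\to\psi)\cap\mathcal E(s,\varphi)\subseteq\mathcal E([t\cdot s],\psi)$ and $\mathcal E(s,\varphi)\cup\mathcal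 E(t,\varphi)\subseteq\mathcal E([s+t],\varphi)$; - $\mathcal E(t,\varphi)\subseteq\mathcal E(!t,t{:}_X\varphi)$ for each finite $X\subseteq\mathcal D$ that contains all members of $\mathcal D$ occurring in $\varphi$; - if $w\in\mathcal E(t,\varphi)$ and $w\mathcal Rw'$, then $w'\in\mathcal E(t,\varphi)$; - $\mathcal E(t,\varphi(x))\subseteq\mathcal E(t,\varphi(a))$ for $a\in\mathcal D$, and $\mathcal E(t,\varphi)\subseteq\mathcal E(\mathsf{gen}_x(t),\forall x\varphi)$; - if $w\in\mathcal E(t,\varphi(a))$ for every $a\in\mathcal D$, then $w\in\mathcal E(\mathsf b(t),\forall y\,\varphi(y))$. The model *meets* $\mathcal{CS}$ if $\mathcal E(c,\varphi)=\mathcal W$ whenever $c{:}\varphi\in\mathcal{CS}$. Truth of closed $\mathcal D$-formulas at $w$: $P(\vec a)$ is true iff $\vec a\in\mathcal I(P,w)$; $\bot$ is not true; $\to$ is classical; $\forall x\psi(x)$ is true iff $\psi(a)$ is true at $w$ for every $a\in\mathcal D$; and $t{:}_X\psi(\vec x)$, with $\vec x$ the free variables of $\psi$, is true at $w$ iff $w\in\mathcal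 E(t,\psi(\vec x))$ and $\psi(\vec a)$ is true at every $w'$ with $w\mathcal Rw'$ for all $\vec a\in\mathcal D$. For a closed formula $\varphi$, $\Vdash_{\mathcal{CS}}\varphi$ means that $\varphi$ is true at every world of every Fitting model for $\mathsf{FOLPb}$ that meets $\mathcal{CS}$. **Theorem (Completeness for $\mathsf{FOLPb}$).** Let $\mathcal{CS}$ be a variant closed and axiomatically appropriate constant specification. For every closed formula $\varphi$ (without members of a domain), if $\Vdash_{\mathcal{CS}}\varphi$, then $\vdash_{\mathcal{CS}}\varphi$. -/

import Mathlib

namespace FOLPb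

/-- Justification terms: variables `p_i`, constants `c_i`, application `t · s`, sum `t + s`,
`! t`, `b(t)` and `gen_x(t)`, where `x` is (the index of) an individual variable. -/
inductive JTerm : Type where
  | var (i : ℕ)
  | const (i : ℕ)
  | app (t s : JTerm)
  | sum (t s : JTerm)
  | bang (t : JTerm)
  | b (t : JTerm)
  | gen (x : ℕ) (t : JTerm)

/-- Formulas whose individuals are the individual variables `x_0, x_1, …` (`Sum.inl`) and the
elements of `D` (`Sum.inr`). Elements of `D` are never quantified and never subscripts of `gen`.
`rel n P args` is the `P`-th `n`-ary predicate symbol applied to `args`; `just t X φ` is `t :_X φ`.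
The formulas of the language itself are those with `D = Empty`. -/
inductive Formula (D : Type) : Type where
  | rel (n P : ℕ) (args : Fin n → ℕ ⊕ D)
  | bot
  | imp (φ ψ : Formula D)
  | all (x : ℕ) (φ : Formula D)
  | just (t : JTerm) (X : Finset (ℕ ⊕ D)) (φ : Formula D)

/-- The set `Fml_J` of formulas of first-order justification logic. -/
abbrev Fml : Type := Formula Empty

namespace Formula

variable {D E : Type}

/-- The individuals with a free occurrence; in particular `fv (t :_X φ) = X`. -/
def fv : Formula D → Set (ℕ ⊕ D)
  | rel _ _ args => Set.range args
  | bot => ∅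
  | imp φ ψ => fv φ ∪ fv ψ
  | all x φ => fv φ \ {Sum.inl x}
  | just _ X _ => (X : Set (ℕ ⊕ D))

/-- A formula is closed if no individual variable is free in it (elements of `D` may occur). -/
def Closed (φ : Formula D) : Prop := ∀ x : ℕ, Sum.inl x ∉ φ.fv

open Classical in
/-- The replacement `σ`, switched off on the individual variables in `B`. -/
noncomputable def shield (σ : ℕ ⊕ D → ℕ ⊕ E) (B : Set ℕ) : ℕ ⊕ D → ℕ ⊕ E
  | Sum.inl y => if y ∈ B then Sum.inl y else σ (Sum.inl y)
  | Sum.inr d => σ (Sum.inr d)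

open Classical in
/-- Simultaneous replacement of all free occurrences of individuals according to `σ`.
Below `∀ x` the variable `x` is left alone, and below `t :_X` the variables outside `X` are. -/
noncomputable def subst : (ℕ ⊕ D → ℕ ⊕ E) → Formula D → Formula E
  | σ, rel n P args => rel n P (fun i => σ (args i))
  | _, bot => bot
  | σ, imp φ ψ => imp (subst σ φ) (subst σ ψ)
  | σ, all x φ => all x (subst (shield σ {x}) φ)
  | σ, just t X φ => just t (X.image σ) (subst (shield σ {y | Sum.inl y ∉ X}) φ)

open Classical in
/-- The replacement `σ` is free for `φ`: no replaced occurrence falls under a quantifier that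
binds its new value, and in `t :_X φ` no variable that is free in `φ` but not in `X` is among the
individuals put in place of the members of `X`. -/
def FreeFor : (ℕ ⊕ D → ℕ ⊕ E) → Formula D → Prop
  | _, rel _ _ _ => True
  | _, bot => True
  | σ, imp φ ψ => FreeFor σ φ ∧ FreeFor σ ψ
  | σ, all x φ => FreeFor (shield σ {x}) φ ∧
      ∀ z ∈ φ.fv, z ≠ Sum.inl x → σ z ≠ Sum.inl x
  | σ, just _ X φ => FreeFor (shield σ {y | Sum.inl y ∉ X}) φ ∧
      ∀ z ∈ φ.fv, z ∉ X → shield σ {y | Sum.inl y ∉ X} z ∉ X.image σ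

open Classical in
/-- The replacement of the single variable `x` by the individual `z`. -/
noncomputable def single (x : ℕ) (z : ℕ ⊕ D) : ℕ ⊕ D → ℕ ⊕ D :=
  fun u => if u = Sum.inl x then z else u

/-- `φ(a)` for `φ(x)` and `a` in `D`. -/
noncomputable def inst (x : ℕ) (a : D) (φ : Formula D) : Formula D :=
  φ.subst (single x (Sum.inr a))

/-- All free individual variables replaced by elements of `D`. -/
noncomputable def instAll (v : ℕ → D) (φ : Formula D) : Formula D :=
  φ.subst (Sum.elim (fun y => Sum.inr (v y)) Sum.inr)

/-- A formula of the language, read as a formula in which elements of `D` might occur. -/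
noncomputable def embed (φ : Fml) : Formula D :=
  φ.subst (Sum.map id Empty.elim)

/-- The `D`-formulas: the results of putting elements of `D` in place of *free* occurrences of
variables in formulas of the language. Thus an element of `D` that occurs in `φ` has to be in `X`
whenever `t :_X φ` is a subformula. -/
def IsDFormula : Formula D → Prop
  | rel _ _ _ => True
  | bot => True
  | imp φ ψ => IsDFormula φ ∧ IsDFormula ψ
  | all _ φ => IsDFormula φ
  | just _ X φ => IsDFormula φ ∧ ∀ d : D, Sum.inr d ∈ φ.fv → Sum.inr d ∈ X

/-- `φ` and `ψ` are variable variants: `ψ` arises from `φ` by a one-to-one renaming of the free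
individuals under which no occurrence is captured. -/
def Variant (φ ψ : Formula D) : Prop :=
  ∃ σ : ℕ ⊕ D → ℕ ⊕ D, Set.InjOn σ φ.fv ∧ φ.FreeFor σ ∧ ψ = φ.subst σ

/-- The number of connectives, quantifiers and justification operators. -/
def degree : Formula D → ℕ
  | rel _ _ _ => 0
  | bot => 0
  | imp φ ψ => degree φ + degree ψ + 1
  | all _ φ => degree φ + 1
  | just _ _ φ => degree φ + 1

theorem degree_subst (φ : Formula D) :
    ∀ σ : ℕ ⊕ D → ℕ ⊕ E, (φ.subst σ).degree = φ.degree := by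
  induction φ with
  | rel n P args => intro σ; rfl
  | bot => intro σ; rfl
  | imp φ ψ ih1 ih2 => intro σ; simp [subst, degree, ih1, ih2]
  | all x φ ih => intro σ; simp [subst, degree, ih]
  | just t X φ ih => intro σ; simp [subst, degree, ih]

end Formula

open Formula

open Classical in
/-- The axioms of `FOLPb_0`. The first five schemes axiomatize classical first-order logic
with `→`, `⊥`, `∀` (together with modus ponens and generalization). -/
inductive Axiom {D : Type} : Formula D → Prop where
  | a1K (φ ψ : Formula D) : Axiom (imp φ (imp ψ φ))
  | a1S (φ ψ χ : Formula D) :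
      Axiom (imp (imp φ (imp ψ χ)) (imp (imp φ ψ) (imp φ χ)))
  | a1N (φ : Formula D) : Axiom (imp (imp (imp φ bot) bot) φ)
  | a1Inst (x : ℕ) (z : ℕ ⊕ D) (φ : Formula D) (h : φ.FreeFor (single x z)) :
      Axiom (imp (all x φ) (φ.subst (single x z)))
  | a1Dist (x : ℕ) (φ ψ : Formula D) (h : Sum.inl x ∉ φ.fv) :
      Axiom (imp (all x (imp φ ψ)) (imp φ (all x ψ)))
  | a2 (t : JTerm) (X : Finset (ℕ ⊕ D)) (y : ℕ ⊕ D) (φ : Formula D)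
      (hX : y ∉ X) (h : y ∉ φ.fv) :
      Axiom (imp (just t (insert y X) φ) (just t X φ))
  | a3 (t : JTerm) (X : Finset (ℕ ⊕ D)) (y : ℕ ⊕ D) (φ : Formula D) (hX : y ∉ X) :
      Axiom (imp (just t X φ) (just t (insert y X) φ))
  | b1 (t : JTerm) (X : Finset (ℕ ⊕ D)) (φ : Formula D) :
      Axiom (imp (just t X φ) φ)
  | b2 (t s : JTerm) (X : Finset (ℕ ⊕ D)) (φ ψ : Formula D) :
      Axiom (imp (just t X (imp φ ψ)) (imp (just s X φ) (just (.app t s) X ψ)))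
  | b3Left (t s : JTerm) (X : Finset (ℕ ⊕ D)) (φ : Formula D) :
      Axiom (imp (just t X φ) (just (.sum t s) X φ))
  | b3Right (t s : JTerm) (X : Finset (ℕ ⊕ D)) (φ : Formula D) :
      Axiom (imp (just s X φ) (just (.sum t s) X φ))
  | b4 (t : JTerm) (X : Finset (ℕ ⊕ D)) (φ : Formula D) :
      Axiom (imp (just t X φ) (just (.bang t) X (just t X φ)))
  | b5 (t : JTerm) (X : Finset (ℕ ⊕ D)) (x : ℕ) (φ : Formula D) (hx : Sum.inl x ∉ X) :
      Axiom (imp (just t X φ) (just (.gen x t) X (all x φ)))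
  | bb (t : JTerm) (X : Finset (ℕ ⊕ D)) (y : ℕ) (φ : Formula D) (hy : Sum.inl y ∉ X) :
      Axiom (imp (all y (just t (insert (Sum.inl y) X) φ)) (just (.b t) X (all y φ)))

/-- Provability in `FOLPb_CS`. -/
inductive Provable {D : Type} (CS : Set (Formula D)) : Formula D → Prop where
  | ax {φ : Formula D} (h : Axiom φ) : Provable CS φ
  | cs {φ : Formula D} (h : φ ∈ CS) : Provable CS φ
  | mp {φ ψ : Formula D} (h₁ : Provable CS (imp φ ψ)) (h₂ : Provable CS φ) : Provable CS ψ
  | gen {φ : Formula D} (x : ℕ) (h : Provable CS φ) : Provable CS (all x φ)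

/-- `CS` is a constant specification: each member is `c : ψ` with `c` a justification constant
and `ψ` an axiom. -/
def IsConstantSpecification (CS : Set Fml) : Prop :=
  ∀ χ ∈ CS, ∃ (c : ℕ) (ψ : Fml), Axiom ψ ∧ χ = just (.const c) ∅ ψ

/-- Every axiom has a justification constant in `CS`. -/
def AxiomaticallyAppropriate (CS : Set Fml) : Prop :=
  ∀ ψ : Fml, Axiom ψ → ∃ c : ℕ, just (.const c) ∅ ψ ∈ CS

/-- `CS` has the same constants for any two axioms that are variable variants. (A variable variant
of an axiom need not be an axiom: rename the last `y` in `t :_∅ P(y) → P(y)`. As only axioms are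
given constants, the condition compares axioms.) -/
def VariantClosed (CS : Set Fml) : Prop :=
  ∀ φ ψ : Fml, Axiom φ → Axiom ψ → Variant φ ψ →
    ∀ c : ℕ, just (.const c) ∅ φ ∈ CS ↔ just (.const c) ∅ ψ ∈ CS

/-- Fitting models with constant domain. The values of the evidence function `Ev` matter on
`D`-formulas only. -/
structure FittingModel where
  /-- possible worlds -/
  W : Type
  /-- the domain -/
  D : Type
  nonemptyW : Nonempty W
  nonemptyD : Nonempty D
  /-- accessibility -/
  R : W → W → Prop
  /-- the interpretation of the `P`-th `n`-ary predicate symbol at a world -/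
  I : (n P : ℕ) → W → Set (Fin n → D)
  /-- the evidence function -/
  Ev : JTerm → Formula D → Set W
  app_cond : ∀ (t s : JTerm) (φ ψ : Formula D), φ.IsDFormula → ψ.IsDFormula →
    Ev t (imp φ ψ) ∩ Ev s φ ⊆ Ev (.app t s) ψ
  sum_cond : ∀ (t s : JTerm) (φ : Formula D), φ.IsDFormula →
    Ev s φ ∪ Ev t φ ⊆ Ev (.sum s t) φ
  bang_cond : ∀ (t : JTerm) (φ : Formula D) (X : Finset D), φ.IsDFormula →
    (∀ d : D, Sum.inr d ∈ φ.fv → d ∈ X) →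
    Ev t φ ⊆ Ev (.bang t) (just t (X.map Function.Embedding.inr) φ)
  closure_cond : ∀ (t : JTerm) (φ : Formula D) (w w' : W), φ.IsDFormula →
    w ∈ Ev t φ → R w w' → w' ∈ Ev t φ
  inst_cond : ∀ (t : JTerm) (φ : Formula D) (x : ℕ) (a : D), φ.IsDFormula →
    Ev t φ ⊆ Ev t (φ.inst x a)
  gen_cond : ∀ (t : JTerm) (φ : Formula D) (x : ℕ), φ.IsDFormula →
    Ev t φ ⊆ Ev (.gen x t) (all x φ)
  b_cond : ∀ (t : JTerm) (φ : Formula D) (y : ℕ) (w : W), φ.IsDFormula →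
    (∀ a : D, w ∈ Ev t (φ.inst y a)) → w ∈ Ev (.b t) (all y φ)

namespace FittingModel

/-- Fitting models for `FOLPb`: accessibility is reflexive and transitive. -/
def IsFOLPb (M : FittingModel) : Prop :=
  (∀ w, M.R w w) ∧ ∀ u v w, M.R u v → M.R v w → M.R u w

/-- The model meets the constant specification `CS`. -/
def Meets (M : FittingModel) (CS : Set Fml) : Prop :=
  ∀ (c : ℕ) (φ : Fml), just (.const c) ∅ φ ∈ CS → M.Ev (.const c) φ.embed = Set.univ

/-- `M.Sat w φ`: the closed `D`-formula `φ` is true at the world `w`. -/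
def Sat (M : FittingModel) (w : M.W) : Formula M.D → Prop
  | rel n P args => ∃ a : Fin n → M.D, (∀ i, args i = Sum.inr (a i)) ∧ a ∈ M.I n P w
  | bot => False
  | imp φ ψ => Sat M w φ → Sat M w ψ
  | all x φ => ∀ a : M.D, Sat M w (φ.inst x a)
  | just t _ φ => w ∈ M.Ev t φ ∧
      ∀ w' : M.W, M.R w w' → ∀ v : ℕ → M.D, Sat M w' (φ.instAll v)
termination_by φ => φ.degree
decreasing_by
  all_goals simp only [Formula.inst, Formula.instAll, Formula.degree_subst, Formula.degree]
  all_goals omega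

end FittingModel

/-- The closed formula `φ` is valid in every Fitting model for `FOLPb` meeting `CS`. -/
def Valid (CS : Set Fml) (φ : Fml) : Prop :=
  ∀ M : FittingModel, M.IsFOLPb → M.Meets CS → ∀ w : M.W, M.Sat w φ.embed

end FOLPb

/-! ### Calculus of single-variable substitutions -/

namespace FOLPb

open Formula

namespace Formula

variable {D E F : Type}

/-! The proof is a Henkin construction whose countermodel has only one world. Natural numbers serve
as domain elements, that is, as parameters that are never bound. If φ is not derivable, it is not
derivable with parameters either: a derivation mentions only finitely many variables, so its
parameters can be turned into distinct fresh variables (`Provable.exists_subst`,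
`Provable.of_embed`). The same device yields generalization on a parameter
(`Provable.imp_all_of_inst`), and hence an extension of ¬φ to a maximal consistent set w containing
a counterexample to every universal formula outside w (`exists_isHenkinSet`).

In the model, t is evidence for ψ iff t:_X ψ ∈ w for some set X of domain elements. By A2 and A3 the
choice of X is immaterial as long as it contains the domain elements free in ψ
(`IsHenkinSet.just_mem_of_hasEvidence`). The conditions on evidence then mirror the axioms; the one
for b combines Bb with the Henkin property (`IsHenkinSet.hasEvidence_b`).

One world suffices because t:_X ψ ∈ w puts every full instance of ψ into w, by instantiation and B1.
So the second half of the truth clause of t:_X ψ is automatic once evidence is present, and t:_X ψ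
can fail only through lack of evidence (`IsHenkinSet.model_sat_iff`). -/

theorem shield_single_of_mem {x : ℕ} {B : Set ℕ} (z : ℕ ⊕ D) (h : x ∈ B) :
    shield (single x z) B = id := by
  funext u
  rcases u with y | d
  · by_cases hy : y ∈ B
    · simp [shield, hy]
    · have : y ≠ x := by rintro rfl; exact hy h
      simp [shield, single, hy, this]
  · simp [shield, single]

theorem shield_single_of_notMem {x : ℕ} {B : Set ℕ} (z : ℕ ⊕ D) (h : x ∉ B) :
    shield (single x z) B = single x z := by
  funext u
  rcases u with y | d
  · by_cases hy : y ∈ B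
    · have : y ≠ x := by rintro rfl; exact h hy
      simp [shield, single, hy, this]
    · simp [shield, hy]
  · simp [shield]

theorem shield_of_fixes {σ : ℕ ⊕ D → ℕ ⊕ E} (h : ∀ x, σ (Sum.inl x) = Sum.inl x)
    (B : Set ℕ) : shield σ B = σ := by
  funext u
  rcases u with y | d
  · simp [shield, h]
  · simp [shield]

theorem shield_id (B : Set ℕ) : shield (id : ℕ ⊕ D → ℕ ⊕ D) B = id :=
  shield_of_fixes (fun _ => rfl) B

theorem subst_id (φ : Formula D) : φ.subst id = φ := by
  induction φ with
  | rel n P args => rfl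
  | bot => rfl
  | imp φ ψ ih₁ ih₂ => simp only [subst, ih₁, ih₂]
  | all x φ ih => simp only [subst, shield_id, ih]
  | just t X φ ih => simp only [subst, shield_id, ih, Finset.image_id]

theorem freeFor_id (φ : Formula D) : φ.FreeFor id := by
  induction φ with
  | rel n P args => trivial
  | bot => trivial
  | imp φ ψ ih₁ ih₂ => exact ⟨ih₁, ih₂⟩
  | all x φ ih => simpa [FreeFor, shield_id] using ih
  | just t X φ ih => simpa [FreeFor, shield_id] using ih

/-- Two replacements that agree on the elements of the domain and on the free variables of a
formula have the same effect on it. -/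
theorem subst_congr (φ : Formula D) : ∀ {σ τ : ℕ ⊕ D → ℕ ⊕ E},
    (∀ x, Sum.inl x ∈ φ.fv → σ (Sum.inl x) = τ (Sum.inl x)) →
    (∀ d, σ (Sum.inr d) = τ (Sum.inr d)) → φ.subst σ = φ.subst τ := by
  classical
  induction φ with
  | rel n P args =>
    intro σ τ h₁ h₂
    simp only [subst]
    congr 1
    funext i
    rcases h : args i with x | d
    · exact h₁ x ⟨i, h⟩
    · exact h₂ d
  | bot => intros; rfl
  | imp φ ψ ih₁ ih₂ =>
    intro σ τ h₁ h₂
    simp only [subst]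
    rw [ih₁ (fun x hx => h₁ x (Or.inl hx)) h₂, ih₂ (fun x hx => h₁ x (Or.inr hx)) h₂]
  | all y φ ih =>
    intro σ τ h₁ h₂
    simp only [subst]
    rw [ih (σ := shield σ {y}) (τ := shield τ {y}) (fun x hx => ?_) (fun d => h₂ d)]
    by_cases hxy : x = y
    · simp [shield, hxy]
    · simpa [shield, hxy] using h₁ x ⟨hx, by simpa using hxy⟩
  | just t X φ ih =>
    intro σ τ h₁ h₂
    simp only [subst]
    rw [ih (σ := shield σ {y | Sum.inl y ∉ X})
      (τ := shield τ {y | Sum.inl y ∉ X}) (fun x hx => ?_) (fun d => h₂ d)]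
    · congr 1
      refine Finset.image_congr fun u hu => ?_
      rcases u with x | d
      · exact h₁ x hu
      · exact h₂ d
    · by_cases hX : Sum.inl x ∈ X
      · simpa [shield, hX] using h₁ x hX
      · simp [shield, hX]

theorem subst_eq_self {φ : Formula D} {σ : ℕ ⊕ D → ℕ ⊕ D}
    (h₁ : ∀ x, Sum.inl x ∈ φ.fv → σ (Sum.inl x) = Sum.inl x)
    (h₂ : ∀ d, σ (Sum.inr d) = Sum.inr d) : φ.subst σ = φ :=
  (subst_congr φ (τ := id) h₁ h₂).trans (subst_id φ)

theorem single_self (x : ℕ) (z : ℕ ⊕ D) : single x z (Sum.inl x) = z := by simp [single]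

theorem single_of_ne {x : ℕ} {z u : ℕ ⊕ D} (h : u ≠ Sum.inl x) : single x z u = u := by
  simp [single, h]

theorem subst_single_of_notMem {x : ℕ} {φ : Formula D} (z : ℕ ⊕ D) (h : Sum.inl x ∉ φ.fv) :
    φ.subst (single x z) = φ := by
  refine subst_eq_self (fun y hy => single_of_ne ?_) (fun d => single_of_ne (by simp))
  rintro e
  exact h (e ▸ hy)

theorem subst_single_all_self (x : ℕ) (z : ℕ ⊕ D) (φ : Formula D) :
    (all x φ).subst (single x z) = all x φ :=
  subst_single_of_notMem z (by simp [fv])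

theorem subst_single_all {x y : ℕ} (z : ℕ ⊕ D) (φ : Formula D) (h : x ≠ y) :
    (all y φ).subst (single x z) = all y (φ.subst (single x z)) := by
  simp only [subst]
  rw [shield_single_of_notMem z (by simpa using h)]

theorem subst_single_just_of_notMem {x : ℕ} (z : ℕ ⊕ D) (t : JTerm) {X : Finset (ℕ ⊕ D)}
    (φ : Formula D) (h : Sum.inl x ∉ X) : (just t X φ).subst (single x z) = just t X φ :=
  subst_single_of_notMem z h

open Classical in
theorem subst_single_just_of_mem {x : ℕ} (z : ℕ ⊕ D) (t : JTerm) {X : Finset (ℕ ⊕ D)}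
    (φ : Formula D) (h : Sum.inl x ∈ X) :
    (just t X φ).subst (single x z) = just t (X.image (single x z)) (φ.subst (single x z)) := by
  simp only [subst]
  rw [shield_single_of_notMem z (by simpa using h)]

/-- Shielding a single-variable replacement is all or nothing: it gives the identity or changes
nothing. As individuals other than x stay put, only the new value z can be captured. -/
theorem freeFor_single_all_iff {x y : ℕ} {z : ℕ ⊕ D} {φ : Formula D} :
    (all y φ).FreeFor (single x z) ↔
      x = y ∨ φ.FreeFor (single x z) ∧ (Sum.inl x ∈ φ.fv → z ≠ Sum.inl y) := by
  simp only [FreeFor]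
  by_cases h : x = y
  · subst h
    rw [shield_single_of_mem z (by simp)]
    simp only [freeFor_id, true_and, true_or, iff_true]
    intro u _ hu
    rwa [single_of_ne hu]
  · rw [shield_single_of_notMem z (by simpa using h)]
    simp only [h, false_or]
    refine and_congr_right fun _ => ⟨fun H hx => ?_, fun H u hu huy => ?_⟩
    · simpa [single_self] using H _ hx (by simpa using h)
    · by_cases hux : u = Sum.inl x
      · subst hux
        rw [single_self]
        exact H hu
      · rwa [single_of_ne hux]

theorem freeFor_single_just_iff {x : ℕ} {z : ℕ ⊕ D} {t : JTerm} {X : Finset (ℕ ⊕ D)}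
    {φ : Formula D} : (just t X φ).FreeFor (single x z) ↔
      Sum.inl x ∉ X ∨ φ.FreeFor (single x z) ∧ (z ∈ φ.fv → z ∈ X) := by
  classical
  simp only [FreeFor]
  by_cases h : Sum.inl x ∈ X
  · rw [shield_single_of_notMem z (by simpa using h)]
    simp only [h, not_true_eq_false, false_or]
    refine and_congr_right fun _ => ⟨fun H hz => ?_, fun H u hu huX hm => ?_⟩
    · by_contra hzX
      have hzx : z ≠ Sum.inl x := by rintro rfl; exact hzX h
      refine H z hz hzX ?_
      rw [single_of_ne hzx]
      exact Finset.mem_image.2 ⟨_, h, single_self x z⟩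
    · have hux : u ≠ Sum.inl x := by rintro rfl; exact huX h
      rw [single_of_ne hux] at hm
      obtain ⟨v, hv, hvu⟩ := Finset.mem_image.1 hm
      by_cases hvx : v = Sum.inl x
      · subst hvx
        rw [single_self] at hvu
        subst hvu
        exact huX (H hu)
      · rw [single_of_ne hvx] at hvu
        exact huX (hvu ▸ hv)
  · rw [shield_single_of_mem z (by simpa using h)]
    simp only [freeFor_id, true_and, h, not_false_eq_true, true_or, iff_true]
    intro u _ huX hm
    obtain ⟨v, hv, hvu⟩ := Finset.mem_image.1 hm
    have hvx : v ≠ Sum.inl x := by rintro rfl; exact h hv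
    rw [single_of_ne hvx] at hvu
    have hvu' : v = u := hvu
    exact huX (hvu' ▸ hv)

theorem freeFor_single_of_notMem {x : ℕ} (z : ℕ ⊕ D) {φ : Formula D} :
    Sum.inl x ∉ φ.fv → φ.FreeFor (single x z) := by
  induction φ with
  | rel n P args => intro _; trivial
  | bot => intro _; trivial
  | imp φ ψ ih₁ ih₂ =>
    intro h
    exact ⟨ih₁ fun hx => h (Or.inl hx), ih₂ fun hx => h (Or.inr hx)⟩
  | all y φ ih =>
    intro h
    rw [freeFor_single_all_iff]
    by_cases hxy : x = y
    · exact Or.inl hxy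
    · have hx : Sum.inl x ∉ φ.fv := fun hx => h ⟨hx, by simpa using hxy⟩
      exact Or.inr ⟨ih hx, fun hx' => absurd hx' hx⟩
  | just t X φ ih =>
    intro h
    exact freeFor_single_just_iff.2 (Or.inl h)

/-- Only an inclusion holds without a freeness hypothesis, since z may be captured. -/
theorem mem_fv_subst_single {x : ℕ} {z u : ℕ ⊕ D} {φ : Formula D} :
    u ∈ (φ.subst (single x z)).fv →
      u ∈ φ.fv ∧ u ≠ Sum.inl x ∨ u = z ∧ Sum.inl x ∈ φ.fv := by
  classical
  have key : ∀ v, single x z v = u → v ≠ Sum.inl x ∧ v = u ∨ v = Sum.inl x ∧ u = z := by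
    intro v hv
    by_cases h : v = Sum.inl x
    · subst h
      rw [single_self] at hv
      exact Or.inr ⟨rfl, hv.symm⟩
    · rw [single_of_ne h] at hv
      exact Or.inl ⟨h, hv⟩
  induction φ with
  | rel n P args =>
    rintro ⟨i, hi⟩
    rcases key _ hi with ⟨h₁, h₂⟩ | ⟨h₁, h₂⟩
    · exact Or.inl ⟨⟨i, h₂⟩, h₂ ▸ h₁⟩
    · exact Or.inr ⟨h₂, i, h₁⟩
  | bot => intro h; exact h.elim
  | imp φ ψ ih₁ ih₂ =>
    rintro (h | h)
    · exact (ih₁ h).imp (fun h => ⟨Or.inl h.1, h.2⟩) (fun h => ⟨h.1, Or.inl h.2⟩)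
    · exact (ih₂ h).imp (fun h => ⟨Or.inr h.1, h.2⟩) (fun h => ⟨h.1, Or.inr h.2⟩)
  | all y φ ih =>
    by_cases hxy : x = y
    · subst hxy
      rw [subst_single_all_self]
      exact fun h => Or.inl ⟨h, h.2⟩
    · rw [subst_single_all z φ hxy]
      rintro ⟨h, hy⟩
      exact (ih h).imp (fun h => ⟨⟨h.1, hy⟩, h.2⟩)
        (fun h => ⟨h.1, h.2, by simpa using hxy⟩)
  | just t X φ ih =>
    by_cases hx : Sum.inl x ∈ X
    · rw [subst_single_just_of_mem z t φ hx]
      intro h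
      obtain ⟨v, hv, hvu⟩ := Finset.mem_image.1 (Finset.mem_coe.1 h)
      rcases key _ hvu with ⟨h₁, rfl⟩ | ⟨rfl, h₂⟩
      · exact Or.inl ⟨hv, h₁⟩
      · exact Or.inr ⟨h₂, hv⟩
    · rw [subst_single_just_of_notMem z t φ hx]
      intro h
      refine Or.inl ⟨h, ?_⟩
      rintro rfl
      exact hx h

/-! ### Renaming by a new variable, and composition of substitutions -/

/-- All individuals that occur in a formula, free or not. -/
def individuals : Formula D → Set (ℕ ⊕ D)
  | rel _ _ args => Set.range args
  | bot => ∅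
  | imp φ ψ => individuals φ ∪ individuals ψ
  | all x φ => insert (Sum.inl x) (individuals φ)
  | just _ X φ => (X : Set (ℕ ⊕ D)) ∪ individuals φ

theorem finite_individuals (φ : Formula D) : φ.individuals.Finite := by
  induction φ with
  | rel n P args => exact Set.finite_range args
  | bot => exact Set.finite_empty
  | imp φ ψ ih₁ ih₂ => exact ih₁.union ih₂
  | all x φ ih => exact ih.insert _
  | just t X φ ih => exact X.finite_toSet.union ih

theorem fv_subset_individuals (φ : Formula D) : φ.fv ⊆ φ.individuals := by
  induction φ with
  | rel n P args => exact subset_rfl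
  | bot => exact subset_rfl
  | imp φ ψ ih₁ ih₂ => exact Set.union_subset_union ih₁ ih₂
  | all x φ ih => exact fun u hu => Or.inr (ih hu.1)
  | just t X φ ih => exact Set.subset_union_left

theorem finite_fv (φ : Formula D) : φ.fv.Finite :=
  φ.finite_individuals.subset φ.fv_subset_individuals

theorem exists_var_bound {S : Set (ℕ ⊕ D)} (hS : S.Finite) :
    ∃ N : ℕ, ∀ x, Sum.inl x ∈ S → x < N := by
  obtain ⟨N, hN⟩ := (hS.preimage (f := Sum.inl) Sum.inl_injective.injOn).bddAbove
  exact ⟨N + 1, fun x hx => Nat.lt_succ_of_le (hN hx)⟩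

/-- A renaming of x to a new z can be undone: it puts no z below ∀x, and below a subscript where it
acts x is no longer free. -/
theorem freeFor_single_rename {x z : ℕ} (hzx : z ≠ x) {φ : Formula D} :
    Sum.inl z ∉ φ.individuals →
      (φ.subst (single x (Sum.inl z))).FreeFor (single z (Sum.inl x)) := by
  induction φ with
  | rel n P args => intro _; trivial
  | bot => intro _; trivial
  | imp φ ψ ih₁ ih₂ =>
    intro h
    exact ⟨ih₁ fun hx => h (Or.inl hx), ih₂ fun hx => h (Or.inr hx)⟩
  | all y φ ih =>
    intro h
    by_cases hxy : x = y
    · subst hxy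
      rw [subst_single_all_self]
      exact freeFor_single_of_notMem _ fun hz => h (fv_subset_individuals _ hz)
    · rw [subst_single_all _ _ hxy, freeFor_single_all_iff]
      exact Or.inr ⟨ih fun hz => h (Or.inr hz), fun _ => by simpa using hxy⟩
  | just t X φ ih =>
    intro h
    by_cases hx : Sum.inl x ∈ X
    · rw [subst_single_just_of_mem _ t φ hx, freeFor_single_just_iff]
      refine Or.inr ⟨ih fun hz => h (Or.inr hz), fun hm => ?_⟩
      rcases mem_fv_subst_single hm with h' | h'
      · exact absurd rfl h'.2
      · exact absurd (Sum.inl_injective h'.1).symm hzx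
    · rw [subst_single_just_of_notMem _ t φ hx]
      exact freeFor_single_of_notMem _ fun hz => h (fv_subset_individuals _ hz)

theorem single_single_rename {x z : ℕ} {u : ℕ ⊕ D} (hu : u ≠ Sum.inl z) :
    single z (Sum.inl x) (single x (Sum.inl z) u) = u := by
  by_cases h : u = Sum.inl x
  · subst h
    rw [single_self, single_self]
  · rw [single_of_ne h, single_of_ne hu]

theorem subst_single_rename {x z : ℕ} {φ : Formula D} :
    Sum.inl z ∉ φ.individuals →
      (φ.subst (single x (Sum.inl z))).subst (single z (Sum.inl x)) = φ := by
  classical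
  induction φ with
  | rel n P args =>
    intro h
    simp only [subst]
    congr 1
    funext i
    exact single_single_rename fun hi => h ⟨i, hi⟩
  | bot => intro _; rfl
  | imp φ ψ ih₁ ih₂ =>
    intro h
    simp only [subst]
    rw [ih₁ fun hx => h (Or.inl hx), ih₂ fun hx => h (Or.inr hx)]
  | all y φ ih =>
    intro h
    by_cases hxy : x = y
    · subst hxy
      rw [subst_single_all_self]
      exact subst_single_of_notMem _ fun hz => h (fv_subset_individuals _ hz)
    · have hzy : z ≠ y := by rintro rfl; exact h (Or.inl rfl)
      rw [subst_single_all _ _ hxy, subst_single_all _ _ hzy, ih fun hz => h (Or.inr hz)]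
  | just t X φ ih =>
    intro h
    by_cases hx : Sum.inl x ∈ X
    · rw [subst_single_just_of_mem _ t φ hx, subst_single_just_of_mem _ t _
        (Finset.mem_image.2 ⟨_, hx, single_self _ _⟩), ih fun hz => h (Or.inr hz),
        Finset.image_image]
      congr 1
      refine (Finset.image_congr (g := id) fun u hu => ?_).trans Finset.image_id
      exact single_single_rename fun hz => h (Or.inl (hz ▸ hu))
    · rw [subst_single_just_of_notMem _ t φ hx]
      exact subst_single_of_notMem _ fun hz => h (fv_subset_individuals _ hz)

/-- Shielding is trivial for replacements that fix all variables, so they compose without regard to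
capture. -/
theorem subst_subst_of_fixes (φ : Formula D) {σ : ℕ ⊕ D → ℕ ⊕ E} {τ : ℕ ⊕ E → ℕ ⊕ F}
    (hσ : ∀ x, σ (Sum.inl x) = Sum.inl x) (hτ : ∀ x, τ (Sum.inl x) = Sum.inl x) :
    (φ.subst σ).subst τ = φ.subst (τ ∘ σ) := by
  have hτσ : ∀ x, (τ ∘ σ) (Sum.inl x) = Sum.inl x := fun x => by simp [hσ, hτ]
  induction φ with
  | rel n P args => rfl
  | bot => rfl
  | imp φ ψ ih₁ ih₂ => simp only [subst, ih₁, ih₂]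
  | all y φ ih => simp only [subst, shield_of_fixes hσ, shield_of_fixes hτ, shield_of_fixes hτσ, ih]
  | just t X φ ih =>
    simp only [subst, shield_of_fixes hσ, shield_of_fixes hτ, shield_of_fixes hτσ, ih,
      Finset.image_image]

/-- Domain elements are never shielded, so a value z in the domain is still sent to τ z below every
quantifier and subscript. -/
theorem subst_subst_single_of_eq {x : ℕ} {z : ℕ ⊕ D} (φ : Formula D) :
    ∀ {τ : ℕ ⊕ D → ℕ ⊕ E} (a : D), z = Sum.inr a → τ (Sum.inl x) = τ z →
      (φ.subst (single x z)).subst τ = φ.subst τ := by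
  classical
  have key : ∀ (τ : ℕ ⊕ D → ℕ ⊕ E), τ (Sum.inl x) = τ z → ∀ u, τ (single x z u) = τ u := by
    intro τ h u
    by_cases hu : u = Sum.inl x
    · rw [hu, single_self, h]
    · rw [single_of_ne hu]
  induction φ with
  | rel n P args =>
    intro τ a _ h
    simp only [subst, key τ h]
  | bot => intros; rfl
  | imp φ ψ ih₁ ih₂ =>
    intro τ a hz h
    simp only [subst]
    rw [ih₁ a hz h, ih₂ a hz h]
  | all y φ ih =>
    intro τ a hz h
    by_cases hxy : x = y
    · subst hxy
      rw [subst_single_all_self]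
    · rw [subst_single_all _ _ hxy]
      simp only [subst]
      rw [ih a hz]
      subst hz
      simpa [shield, hxy] using h
  | just t X φ ih =>
    intro τ a hz h
    by_cases hx : Sum.inl x ∈ X
    · rw [subst_single_just_of_mem _ t φ hx]
      simp only [subst, Finset.image_image]
      congr 1
      · exact Finset.image_congr fun u _ => key τ h u
      -- The new subscript induces a different shield, but the two shields differ at most at x,
      -- which is no longer free in the body.
      · rw [← ih (τ := shield τ {y | Sum.inl y ∉ X}) a hz]
        · refine subst_congr _ (fun y hy => ?_) fun d => rfl
          have hyx : y ≠ x := by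
            rintro rfl
            rcases mem_fv_subst_single hy with h' | h'
            · exact h'.2 rfl
            · rw [hz] at h'
              exact Sum.inl_ne_inr h'.1
          have : Sum.inl y ∈ X.image (single x z) ↔ Sum.inl y ∈ X := by
            subst hz
            rw [Finset.mem_image]
            constructor
            · rintro ⟨u, hu, huy⟩
              by_cases hux : u = Sum.inl x
              · rw [hux, single_self] at huy
                exact absurd huy.symm Sum.inl_ne_inr
              · rw [single_of_ne hux] at huy
                exact huy ▸ hu
            · exact fun hu => ⟨_, hu, single_of_ne (by simpa using hyx)⟩
          simp only [shield, Set.mem_ofPred_eq, this]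
          congr
        · subst hz
          simpa [shield, hx] using h
    · rw [subst_single_just_of_notMem _ t φ hx]

/-! ### `D`-formulas and instantiation by domain elements -/

/-- No quantifier captures a domain element; the condition at a subscript is exactly what being a
`D`-formula provides. -/
theorem IsDFormula.freeFor_single {x : ℕ} {a : D} {φ : Formula D} :
    φ.IsDFormula → φ.FreeFor (single x (Sum.inr a)) := by
  induction φ with
  | rel n P args => intro _; trivial
  | bot => intro _; trivial
  | imp φ ψ ih₁ ih₂ => exact fun h => ⟨ih₁ h.1, ih₂ h.2⟩
  | all y φ ih => exact fun h => freeFor_single_all_iff.2 (Or.inr ⟨ih h, fun _ => by simp⟩)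
  | just t X φ ih => exact fun h => freeFor_single_just_iff.2 (Or.inr ⟨ih h.1, h.2 a⟩)

theorem IsDFormula.inst {x : ℕ} {a : D} {φ : Formula D} :
    φ.IsDFormula → (φ.inst x a).IsDFormula := by
  classical
  unfold Formula.inst
  induction φ with
  | rel n P args => intro _; trivial
  | bot => intro _; trivial
  | imp φ ψ ih₁ ih₂ => exact fun h => ⟨ih₁ h.1, ih₂ h.2⟩
  | all y φ ih =>
    intro h
    by_cases hxy : x = y
    · subst hxy
      rwa [subst_single_all_self]
    · rw [subst_single_all _ _ hxy]
      exact ih h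
  | just t X φ ih =>
    intro h
    by_cases hx : Sum.inl x ∈ X
    · rw [subst_single_just_of_mem _ t φ hx]
      refine ⟨ih h.1, fun d hd => Finset.mem_image.2 ?_⟩
      rcases mem_fv_subst_single hd with h' | h'
      · exact ⟨_, h.2 d h'.1, single_of_ne (by simp)⟩
      · exact ⟨_, hx, by rw [single_self, h'.1]⟩
    · rwa [subst_single_just_of_notMem _ t φ hx]

theorem instAll_inst (v : ℕ → D) (x : ℕ) (φ : Formula D) :
    (φ.inst x (v x)).instAll v = φ.instAll v :=
  subst_subst_single_of_eq φ (v x) rfl rfl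

theorem instAll_of_closed (v : ℕ → D) {φ : Formula D} (h : φ.Closed) : φ.instAll v = φ :=
  subst_eq_self (fun x hx => absurd hx (h x)) fun _ => rfl

/-- A property that is preserved when single variables are replaced by their values under `v` is
preserved when all free variables are; moreover, the result is closed. -/
theorem instAll_induction (v : ℕ → D) {P : Formula D → Prop}
    (hP : ∀ φ x, P φ → P (φ.inst x (v x))) {φ : Formula D} (h : P φ) :
    P (φ.instAll v) ∧ (φ.instAll v).Closed := by
  obtain ⟨N, hN⟩ := exists_var_bound φ.finite_fv
  induction N generalizing φ with
  | zero =>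
    have hc : φ.Closed := fun x hx => Nat.not_lt_zero x (hN x hx)
    rw [instAll_of_closed v hc]
    exact ⟨h, hc⟩
  | succ N ih =>
    -- Replacing the variable with index N first does not affect the outcome and lowers the bound on
    -- the free variables.
    rw [← instAll_inst v N φ]
    refine ih (hP φ N h) fun x hx => ?_
    rcases mem_fv_subst_single hx with h' | h'
    · exact lt_of_le_of_ne (Nat.le_of_lt_succ (hN x h'.1)) fun e => h'.2 (congrArg Sum.inl e)
    · exact absurd h'.1 Sum.inl_ne_inr

theorem Closed.inst {x : ℕ} {a : D} {φ : Formula D} (h : (all x φ).Closed) :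
    (φ.inst x a).Closed := by
  intro y hy
  rcases mem_fv_subst_single hy with h' | h'
  · exact h y h'
  · exact Sum.inl_ne_inr h'.1

end Formula

end FOLPb

/-! ### Trading domain elements for fresh variables -/

namespace FOLPb

open Formula

namespace Formula

variable {D E : Type}

/-- A renaming of the elements of a domain by elements of another domain and by individual
variables with index at least `N`, which is one-to-one and leaves the variables alone. -/
structure FreshRenaming (N : ℕ) (σ : ℕ ⊕ D → ℕ ⊕ E) : Prop where
  fixes : ∀ x, σ (Sum.inl x) = Sum.inl x
  injective : Function.Injective fun d => σ (Sum.inr d)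
  fresh : ∀ d x, σ (Sum.inr d) = Sum.inl x → N ≤ x

namespace FreshRenaming

variable {N : ℕ} {σ : ℕ ⊕ D → ℕ ⊕ E}

theorem mono {M : ℕ} (h : FreshRenaming N σ) (hMN : M ≤ N) : FreshRenaming M σ :=
  ⟨h.fixes, h.injective, fun d x hx => hMN.trans (h.fresh d x hx)⟩

/-- Domain elements may become variables of index at least N, so injectivity holds only away from
those variables. -/
theorem eq_of_eq (h : FreshRenaming N σ) {u v : ℕ ⊕ D} (hu : ∀ x, u = Sum.inl x → x < N)
    (hv : ∀ x, v = Sum.inl x → x < N) (huv : σ u = σ v) : u = v := by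
  rcases u with x | d <;> rcases v with y | e
  · rw [h.fixes, h.fixes] at huv
    exact congrArg Sum.inl (Sum.inl_injective huv)
  · rw [h.fixes] at huv
    exact absurd (hu x rfl) (not_lt.2 (h.fresh e x huv.symm))
  · rw [h.fixes] at huv
    exact absurd (hv y rfl) (not_lt.2 (h.fresh d y huv))
  · exact congrArg Sum.inr (h.injective huv)

theorem eq_inl_iff (h : FreshRenaming N σ) {u : ℕ ⊕ D} {x : ℕ} (hx : x < N) :
    σ u = Sum.inl x ↔ u = Sum.inl x := by
  constructor
  · intro hu
    rcases u with y | d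
    · rw [h.fixes] at hu
      exact congrArg Sum.inl (Sum.inl_injective hu)
    · exact absurd hx (not_lt.2 (h.fresh d x hu))
  · rintro rfl
    exact h.fixes x

theorem subst_all (h : FreshRenaming N σ) (x : ℕ) (φ : Formula D) :
    (all x φ).subst σ = all x (φ.subst σ) := by
  simp only [subst, shield_of_fixes h.fixes]

open Classical in
theorem subst_just (h : FreshRenaming N σ) (t : JTerm) (X : Finset (ℕ ⊕ D)) (φ : Formula D) :
    (just t X φ).subst σ = just t (X.image σ) (φ.subst σ) := by
  simp only [subst, shield_of_fixes h.fixes]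

theorem mem_image_inl_iff [DecidableEq (ℕ ⊕ E)] (h : FreshRenaming N σ) {X : Finset (ℕ ⊕ D)}
    {x : ℕ} (hx : x < N) : Sum.inl x ∈ X.image σ ↔ Sum.inl x ∈ X := by
  rw [Finset.mem_image]
  constructor
  · rintro ⟨u, hu, hux⟩
    rwa [(h.eq_inl_iff hx).1 hux] at hu
  · exact fun hu => ⟨_, hu, h.fixes x⟩

/-- The bound covers bound variables too, so that no quantifier captures a fresh variable. -/
theorem fv_subst (h : FreshRenaming N σ) {φ : Formula D} :
    (∀ x, Sum.inl x ∈ φ.individuals → x < N) → (φ.subst σ).fv = σ '' φ.fv := by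
  classical
  induction φ with
  | rel n P args =>
    intro _
    simp only [subst, fv, ← Set.range_comp, Function.comp_def]
  | bot => intro _; simp [subst, fv]
  | imp φ ψ ih₁ ih₂ =>
    intro hN
    simp only [subst, fv, Set.image_union]
    rw [ih₁ fun x hx => hN x (Or.inl hx), ih₂ fun x hx => hN x (Or.inr hx)]
  | all y φ ih =>
    intro hN
    rw [h.subst_all, fv, fv, ih fun x hx => hN x (Or.inr hx)]
    have hy : y < N := hN y (Or.inl rfl)
    ext u
    constructor
    · rintro ⟨⟨v, hv, rfl⟩, hu⟩
      refine ⟨v, ⟨hv, fun hvy => hu ?_⟩, rfl⟩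
      rw [Set.mem_singleton_iff] at hvy ⊢
      exact (h.eq_inl_iff hy).2 hvy
    · rintro ⟨v, ⟨hv, hvy⟩, rfl⟩
      exact ⟨⟨v, hv, rfl⟩, fun hu => hvy ((h.eq_inl_iff hy).1 hu)⟩
  | just t X φ ih =>
    intro _
    rw [h.subst_just, fv, fv, Finset.coe_image]

theorem mem_fv_subst_iff (h : FreshRenaming N σ) {φ : Formula D} {u : ℕ ⊕ D}
    (hφ : ∀ x, Sum.inl x ∈ φ.individuals → x < N) (hu : ∀ x, u = Sum.inl x → x < N) :
    σ u ∈ (φ.subst σ).fv ↔ u ∈ φ.fv := by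
  rw [h.fv_subst hφ]
  constructor
  · rintro ⟨v, hv, hvu⟩
    rwa [h.eq_of_eq (fun x hx => hφ x (fv_subset_individuals φ (hx ▸ hv))) hu hvu] at hv
  · exact fun hu => ⟨u, hu, rfl⟩

theorem mem_image_iff [DecidableEq (ℕ ⊕ E)] (h : FreshRenaming N σ) {X : Finset (ℕ ⊕ D)}
    {u : ℕ ⊕ D} (hX : ∀ x, Sum.inl x ∈ X → x < N) (hu : ∀ x, u = Sum.inl x → x < N) :
    σ u ∈ X.image σ ↔ u ∈ X := by
  rw [Finset.mem_image]
  constructor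
  · rintro ⟨v, hv, hvu⟩
    rwa [h.eq_of_eq (fun x hx => hX x (hx ▸ hv)) hu hvu] at hv
  · exact fun hu => ⟨u, hu, rfl⟩

theorem apply_single (h : FreshRenaming N σ) {x : ℕ} (hx : x < N) (z u : ℕ ⊕ D) :
    σ (single x z u) = single x (σ z) (σ u) := by
  by_cases hu : u = Sum.inl x
  · rw [hu, single_self, h.fixes, single_self]
  · rw [single_of_ne hu, single_of_ne fun h' => hu ((h.eq_inl_iff hx).1 h')]

theorem subst_subst_single (h : FreshRenaming N σ) {x : ℕ} (hx : x < N) (z : ℕ ⊕ D)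
    (φ : Formula D) :
    (φ.subst (single x z)).subst σ = (φ.subst σ).subst (single x (σ z)) := by
  classical
  induction φ with
  | rel n P args => simp only [subst, h.apply_single hx]
  | bot => rfl
  | imp φ ψ ih₁ ih₂ => simp only [subst, ih₁, ih₂]
  | all y φ ih =>
    by_cases hxy : x = y
    · subst hxy
      rw [subst_single_all_self, h.subst_all, subst_single_all_self]
    · rw [subst_single_all _ _ hxy, h.subst_all, h.subst_all, subst_single_all _ _ hxy, ih]
  | just t X φ ih =>
    by_cases hxX : Sum.inl x ∈ X
    · have hxX' : Sum.inl x ∈ X.image σ := (h.mem_image_inl_iff hx).2 hxX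
      rw [subst_single_just_of_mem _ _ _ hxX, h.subst_just, h.subst_just,
        subst_single_just_of_mem _ _ _ hxX', ih, Finset.image_image, Finset.image_image]
      congr 1
      exact Finset.image_congr fun u _ => h.apply_single hx z u
    · have hxX' : Sum.inl x ∉ X.image σ := fun h' => hxX ((h.mem_image_inl_iff hx).1 h')
      rw [subst_single_just_of_notMem _ _ _ hxX, h.subst_just,
        subst_single_just_of_notMem _ _ _ hxX']

theorem freeFor_single (h : FreshRenaming N σ) {x : ℕ} {z : ℕ ⊕ D} (hx : x < N)
    (hz : ∀ y, z = Sum.inl y → y < N) {φ : Formula D} :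
    (∀ x, Sum.inl x ∈ φ.individuals → x < N) → φ.FreeFor (single x z) →
      (φ.subst σ).FreeFor (single x (σ z)) := by
  classical
  have hxs : ∀ y, (Sum.inl x : ℕ ⊕ D) = Sum.inl y → y < N := fun y hy =>
    Sum.inl_injective hy ▸ hx
  induction φ with
  | rel n P args => intros; trivial
  | bot => intros; trivial
  | imp φ ψ ih₁ ih₂ =>
    intro hN hφ
    exact ⟨ih₁ (fun x hx => hN x (Or.inl hx)) hφ.1, ih₂ (fun x hx => hN x (Or.inr hx)) hφ.2⟩
  | all y φ ih =>
    intro hN hφ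
    have hN' : ∀ x, Sum.inl x ∈ φ.individuals → x < N := fun x hx => hN x (Or.inr hx)
    rw [freeFor_single_all_iff] at hφ
    rw [h.subst_all, freeFor_single_all_iff, Ne, h.eq_inl_iff (hN y (Or.inl rfl)), ← h.fixes x,
      h.mem_fv_subst_iff hN' hxs]
    exact hφ.imp_right fun hφ => ⟨ih hN' hφ.1, hφ.2⟩
  | just t X φ ih =>
    intro hN hφ
    have hN' : ∀ x, Sum.inl x ∈ φ.individuals → x < N := fun x hx => hN x (Or.inr hx)
    rw [freeFor_single_just_iff] at hφ
    rw [h.subst_just, freeFor_single_just_iff, h.mem_image_inl_iff hx,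
      h.mem_fv_subst_iff hN' hz, h.mem_image_iff (fun x hx => hN x (Or.inl hx)) hz]
    exact hφ.imp_right fun hφ => ⟨ih hN' hφ.1, hφ.2⟩

end FreshRenaming

theorem freshRenaming_embed (N : ℕ) :
    FreshRenaming N (Sum.map id Empty.elim : ℕ ⊕ Empty → ℕ ⊕ D) :=
  ⟨fun _ => rfl, fun d => d.elim, fun d => d.elim⟩

/-- An embedded formula contains no domain elements. In particular the constant specification is
invariant under fresh renamings. -/
theorem embed_subst (φ : Fml) {σ : ℕ ⊕ D → ℕ ⊕ E} (h : ∀ x, σ (Sum.inl x) = Sum.inl x) :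
    φ.embed.subst σ = φ.embed := by
  unfold embed
  rw [subst_subst_of_fixes φ (fun _ => rfl) h]
  exact subst_congr φ (fun x _ => h x) fun d => d.elim

theorem embed_subst_empty (φ : Fml) {σ : ℕ ⊕ D → ℕ ⊕ Empty}
    (h : ∀ x, σ (Sum.inl x) = Sum.inl x) : φ.embed.subst σ = φ := by
  rw [embed_subst φ h]
  exact subst_eq_self (fun _ _ => rfl) fun d => d.elim

theorem fv_embed (φ : Fml) : (φ.embed : Formula D).fv = Sum.map id Empty.elim '' φ.fv := by
  obtain ⟨N, hN⟩ := exists_var_bound φ.finite_individuals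
  exact (freshRenaming_embed N).fv_subst hN

theorem embed_just_empty (t : JTerm) (φ : Fml) :
    (just t ∅ φ).embed = just t ∅ (φ.embed : Formula D) :=
  (freshRenaming_embed 0).subst_just t ∅ φ

theorem inr_notMem_fv_embed (φ : Fml) (d : D) : Sum.inr d ∉ φ.embed.fv := by
  rw [fv_embed]
  rintro ⟨x | e, _, h⟩
  · exact Sum.inl_ne_inr h
  · exact e.elim

theorem Closed.embed {φ : Fml} (h : φ.Closed) : (φ.embed : Formula D).Closed := by
  intro x hx
  rw [fv_embed] at hx
  obtain ⟨y | e, hy, h'⟩ := hx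
  · exact h y hy
  · exact e.elim

theorem isDFormula_embed (φ : Fml) : (φ.embed : Formula D).IsDFormula := by
  induction φ with
  | rel n P args => trivial
  | bot => trivial
  | imp φ ψ ih₁ ih₂ => exact ⟨ih₁, ih₂⟩
  | all x φ ih =>
    unfold embed
    rw [(freshRenaming_embed 0).subst_all]
    exact ih
  | just t X φ ih =>
    unfold embed
    rw [(freshRenaming_embed 0).subst_just]
    exact ⟨ih, fun d hd => absurd hd (inr_notMem_fv_embed φ d)⟩

theorem subst_eq_self_of_individuals {σ : ℕ ⊕ D → ℕ ⊕ D}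
    (hσ : ∀ x, σ (Sum.inl x) = Sum.inl x) {φ : Formula D} :
    (∀ u ∈ φ.individuals, σ u = u) → φ.subst σ = φ := by
  classical
  induction φ with
  | rel n P args =>
    intro h
    simp only [subst]
    congr 1
    exact funext fun i => h _ ⟨i, rfl⟩
  | bot => intro _; rfl
  | imp φ ψ ih₁ ih₂ =>
    intro h
    simp only [subst, ih₁ fun u hu => h u (Or.inl hu), ih₂ fun u hu => h u (Or.inr hu)]
  | all x φ ih =>
    intro h
    simp only [subst, shield_of_fixes hσ, ih fun u hu => h u (Or.inr hu)]
  | just t X φ ih =>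
    intro h
    simp only [subst, shield_of_fixes hσ, ih fun u hu => h u (Or.inr hu)]
    congr 1
    exact (Finset.image_congr (g := id) fun u hu => h u (Or.inl hu)).trans Finset.image_id

end Formula

/-! ### Transfer of derivations along fresh renamings -/

variable {D E : Type}

/-- Axioms remain axioms if the elements of the domain are replaced by new ones or by fresh
variables. -/
theorem Axiom.exists_subst {φ : Formula D} (h : Axiom φ) :
    ∃ N : ℕ, ∀ (E : Type) (σ : ℕ ⊕ D → ℕ ⊕ E), FreshRenaming N σ → Axiom (φ.subst σ) := by
  classical
  obtain ⟨N, hN⟩ := exists_var_bound φ.finite_individuals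
  cases h with
  | a1K φ ψ => exact ⟨0, fun E σ _ => .a1K _ _⟩
  | a1S φ ψ χ => exact ⟨0, fun E σ _ => .a1S _ _ _⟩
  | a1N φ => exact ⟨0, fun E σ _ => .a1N _⟩
  | a1Inst x z φ h =>
    -- If x is not free in the body, z need not occur in the axiom, so it needs its own bound.
    obtain ⟨M, hM⟩ := exists_var_bound (Set.finite_singleton z)
    refine ⟨max N M, fun E σ hσ => ?_⟩
    have hNσ := hσ.mono (le_max_left N M)
    have hx : x < N := hN x (Or.inl (Or.inl rfl))
    have := Axiom.a1Inst x (σ z) (φ.subst σ) (hσ.freeFor_single (lt_max_of_lt_left hx)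
      (fun y hy => lt_max_of_lt_right (hM y hy.symm))
      (fun y hy => lt_max_of_lt_left (hN y (Or.inl (Or.inr hy)))) h)
    rwa [← hNσ.subst_subst_single hx, ← hNσ.subst_all] at this
  | a1Dist x φ ψ h =>
    refine ⟨N, fun E σ hσ => ?_⟩
    have hx : x < N := hN x (Or.inl (Or.inl rfl))
    simp only [subst, shield_of_fixes hσ.fixes]
    refine .a1Dist _ _ _ ?_
    rwa [← hσ.fixes x, hσ.mem_fv_subst_iff (fun y hy => hN y (Or.inr (Or.inl hy)))
      (fun y hy => Sum.inl_injective hy ▸ hx)]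
  | a2 t X y φ hX h =>
    refine ⟨N, fun E σ hσ => ?_⟩
    have hy : ∀ x, y = Sum.inl x → x < N := fun x hx =>
      hN x (Or.inl (Or.inl (by simp [hx])))
    simp only [subst, shield_of_fixes hσ.fixes, Finset.image_insert]
    refine .a2 _ _ _ _ ?_ ?_
    · rwa [hσ.mem_image_iff (fun x hx => hN x (Or.inr (Or.inl hx))) hy]
    · rwa [hσ.mem_fv_subst_iff (fun x hx => hN x (Or.inr (Or.inr hx))) hy]
  | a3 t X y φ hX =>
    refine ⟨N, fun E σ hσ => ?_⟩
    have hy : ∀ x, y = Sum.inl x → x < N := fun x hx =>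
      hN x (Or.inr (Or.inl (by simp [hx])))
    simp only [subst, shield_of_fixes hσ.fixes, Finset.image_insert]
    refine .a3 _ _ _ _ ?_
    rwa [hσ.mem_image_iff (fun x hx => hN x (Or.inl (Or.inl hx))) hy]
  | b1 t X φ =>
    refine ⟨0, fun E σ hσ => ?_⟩
    simp only [subst, shield_of_fixes hσ.fixes]
    exact .b1 _ _ _
  | b2 t s X φ ψ =>
    refine ⟨0, fun E σ hσ => ?_⟩
    simp only [subst, shield_of_fixes hσ.fixes]
    exact .b2 _ _ _ _ _
  | b3Left t s X φ =>
    refine ⟨0, fun E σ hσ => ?_⟩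
    simp only [subst, shield_of_fixes hσ.fixes]
    exact .b3Left _ _ _ _
  | b3Right t s X φ =>
    refine ⟨0, fun E σ hσ => ?_⟩
    simp only [subst, shield_of_fixes hσ.fixes]
    exact .b3Right _ _ _ _
  | b4 t X φ =>
    refine ⟨0, fun E σ hσ => ?_⟩
    simp only [subst, shield_of_fixes hσ.fixes]
    exact .b4 _ _ _
  | b5 t X x φ hx =>
    refine ⟨N, fun E σ hσ => ?_⟩
    have hxN : x < N := hN x (Or.inr (Or.inr (Or.inl rfl)))
    simp only [subst, shield_of_fixes hσ.fixes]
    exact .b5 _ _ _ _ (by rwa [hσ.mem_image_inl_iff hxN])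
  | bb t X y φ hy =>
    refine ⟨N, fun E σ hσ => ?_⟩
    have hyN : y < N := hN y (Or.inl (Or.inl rfl))
    simp only [subst, shield_of_fixes hσ.fixes, Finset.image_insert, hσ.fixes]
    exact .bb _ _ _ _ (by rwa [hσ.mem_image_inl_iff hyN])

namespace Provable

/-- Provability is preserved if the elements of the domain are replaced by new ones or by fresh
variables. -/
theorem exists_subst {CS : Set (Formula D)} {φ : Formula D} (h : Provable CS φ) :
    ∃ N : ℕ, ∀ (E : Type) (CS' : Set (Formula E)) (σ : ℕ ⊕ D → ℕ ⊕ E), FreshRenaming N σ →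
      (∀ χ ∈ CS, χ.subst σ ∈ CS') → Provable CS' (φ.subst σ) := by
  induction h with
  | ax h =>
    obtain ⟨N, hN⟩ := h.exists_subst
    exact ⟨N, fun E CS' σ hσ _ => .ax (hN E σ hσ)⟩
  | cs h => exact ⟨0, fun E CS' σ _ hCS => .cs (hCS _ h)⟩
  | mp _ _ ih₁ ih₂ =>
    obtain ⟨N, hN⟩ := ih₁
    obtain ⟨M, hM⟩ := ih₂
    exact ⟨max N M, fun E CS' σ hσ hCS =>
      .mp (hN E CS' σ (hσ.mono (le_max_left N M)) hCS)
        (hM E CS' σ (hσ.mono (le_max_right N M)) hCS)⟩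
  | gen x _ ih =>
    obtain ⟨N, hN⟩ := ih
    refine ⟨N, fun E CS' σ hσ hCS => ?_⟩
    rw [hσ.subst_all]
    exact .gen x (hN E CS' σ hσ hCS)

/-- Sending the domain elements injectively to variables beyond those of the given derivation turns
it into a derivation in the original language, with the same conclusion. -/
theorem of_embed [Countable D] {CS : Set Fml} {φ : Fml}
    (h : Provable (D := D) (embed '' CS) φ.embed) : Provable CS φ := by
  obtain ⟨N, hN⟩ := h.exists_subst
  obtain ⟨f, hf⟩ := Countable.exists_injective_nat D
  have hσ : FreshRenaming N
      (Sum.elim Sum.inl fun d => Sum.inl (N + f d) : ℕ ⊕ D → ℕ ⊕ Empty) :=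
    ⟨fun _ => rfl, fun d e h => hf (Nat.add_left_cancel (Sum.inl_injective h)),
      fun d x h => Sum.inl_injective h ▸ Nat.le_add_right _ _⟩
  have := hN Empty CS _ hσ (by
    rintro _ ⟨χ, hχ, rfl⟩
    rwa [embed_subst_empty χ hσ.fixes])
  rwa [embed_subst_empty φ hσ.fixes] at this

/-! ### Propositional reasoning under one hypothesis γ -/

variable {CS : Set (Formula D)} {γ φ ψ χ : Formula D}

theorem imp_of (h : Provable CS φ) (ψ : Formula D) : Provable CS (imp ψ φ) :=
  .mp (.ax (.a1K φ ψ)) h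

theorem imp_mp (h₁ : Provable CS (imp γ (imp φ ψ))) (h₂ : Provable CS (imp γ φ)) :
    Provable CS (imp γ ψ) :=
  .mp (.mp (.ax (.a1S γ φ ψ)) h₁) h₂

theorem imp_refl (φ : Formula D) : Provable CS (imp φ φ) :=
  imp_mp (.ax (.a1K φ (imp φ φ))) (.ax (.a1K φ φ))

theorem imp_trans (h₁ : Provable CS (imp φ ψ)) (h₂ : Provable CS (imp ψ χ)) :
    Provable CS (imp φ χ) :=
  imp_mp (imp_of h₂ φ) h₁

theorem imp_imp_left (h : Provable CS (imp φ ψ)) (χ : Formula D) :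
    Provable CS (imp (imp χ φ) (imp χ ψ)) :=
  .mp (.ax (.a1S χ φ ψ)) (imp_of h χ)

theorem imp_swap (h : Provable CS (imp φ (imp ψ χ))) : Provable CS (imp ψ (imp φ χ)) :=
  imp_trans (.ax (.a1K ψ φ)) (.mp (.ax (.a1S φ ψ χ)) h)

theorem imp_imp_right (h : Provable CS (imp φ ψ)) (χ : Formula D) :
    Provable CS (imp (imp ψ χ) (imp φ χ)) :=
  imp_swap (imp_trans h (imp_swap (imp_refl (imp ψ χ))))

theorem imp_of_imp_not_not (h : Provable CS (imp γ (imp (imp φ bot) bot))) :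
    Provable CS (imp γ φ) :=
  imp_trans h (.ax (.a1N φ))

theorem bot_imp (φ : Formula D) : Provable CS (imp bot φ) :=
  imp_of_imp_not_not (.ax (.a1K bot (imp φ bot)))

end Provable

namespace Formula

/-- Conjunction. -/
def conj (φ ψ : Formula D) : Formula D := imp (imp φ (imp ψ bot)) bot

end Formula

namespace Provable

variable {CS : Set (Formula D)} {γ φ ψ χ : Formula D}

theorem conj_left (γ χ : Formula D) : Provable CS (imp (conj γ χ) γ) :=
  imp_of_imp_not_not (imp_imp_right (imp_imp_left (bot_imp _) γ) bot)

theorem conj_right (γ χ : Formula D) : Provable CS (imp (conj γ χ) χ) :=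
  imp_of_imp_not_not (imp_imp_right (.ax (.a1K _ γ)) bot)

theorem imp_not_of_conj (h : Provable CS (imp (conj γ χ) bot)) :
    Provable CS (imp γ (imp χ bot)) :=
  .mp (.ax (.a1N _)) h

theorem imp_all {x : ℕ} (hx : Sum.inl x ∉ γ.fv) (h : Provable CS (imp γ φ)) :
    Provable CS (imp γ (all x φ)) :=
  .mp (.ax (.a1Dist x γ φ hx)) (.gen x h)

/-- Generalization on an element of the domain. -/
theorem imp_all_of_inst {CS : Set Fml} {x : ℕ} {d : D} (hγ : Sum.inr d ∉ γ.individuals)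
    (hφ : Sum.inr d ∉ φ.individuals)
    (h : Provable (embed '' CS) (imp γ (φ.inst x d))) :
    Provable (embed '' CS) (imp γ (all x φ)) := by
  classical
  obtain ⟨N, hN⟩ := h.exists_subst
  obtain ⟨M, hM⟩ := exists_var_bound
    ((γ.finite_individuals.union φ.finite_individuals).insert (Sum.inl x))
  -- Being at least N makes z fresh for the derivation; being at least M keeps it out of γ and φ and
  -- distinct from x.
  set z := max N M with hz
  have hxM : x < M := hM x (Or.inl rfl)
  have hzM : M ≤ z := le_max_right N M
  let τ : ℕ ⊕ D → ℕ ⊕ D := fun u => if u = Sum.inr d then Sum.inl z else u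
  have hτ : FreshRenaming z τ := by
    refine ⟨fun y => by simp [τ], fun a b hab => ?_, fun a y hy => ?_⟩
    · by_cases ha : a = d <;> by_cases hb : b = d <;> simp_all [τ]
    · by_cases ha : a = d
      · simp only [τ, ha, if_true] at hy
        exact (Sum.inl_injective hy).le
      · simp [τ, ha] at hy
  have hself : ∀ ψ : Formula D, Sum.inr d ∉ ψ.individuals → ψ.subst τ = ψ := fun ψ hψ =>
    subst_eq_self_of_individuals hτ.fixes fun u hu => if_neg (by rintro rfl; exact hψ hu)
  have hzγ : Sum.inl z ∉ γ.fv := fun h' =>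
    (hM z (Or.inr (Or.inl (fv_subset_individuals γ h')))).not_ge hzM
  have hzφ : Sum.inl z ∉ φ.individuals := fun h' => (hM z (Or.inr (Or.inr h'))).not_ge hzM
  have hzx : z ≠ x := (hxM.trans_le hzM).ne'
  have h₁ := hN D (embed '' CS) τ (hτ.mono (le_max_left N M)) (by
    rintro _ ⟨χ, hχ, rfl⟩
    rw [embed_subst χ hτ.fixes]
    exact ⟨χ, hχ, rfl⟩)
  have h₂ : (φ.inst x d).subst τ = φ.subst (single x (Sum.inl z)) := by
    rw [Formula.inst, hτ.subst_subst_single (hxM.trans_le hzM), hself φ hφ]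
    simp [τ]
  have h₃ : Provable (embed '' CS) (imp γ (φ.subst (single x (Sum.inl z)))) := by
    simpa only [subst, hself γ hγ, h₂] using h₁
  -- Substituting x back for z gives ∀z φ(z/x) → φ, hence a change of bound variable from z to x.
  have h₄ := Provable.ax (CS := embed '' CS) (.a1Inst z (Sum.inl x) _
    (freeFor_single_rename hzx hzφ))
  rw [subst_single_rename hzφ] at h₄
  refine imp_trans (imp_all hzγ h₃) (imp_all ?_ h₄)
  rintro ⟨h', -⟩
  rcases mem_fv_subst_single h' with h' | h'
  · exact h'.2 rfl
  · exact hzx (Sum.inl_injective h'.1).symm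

end Provable

end FOLPb

/-! ### Countability of the language -/

namespace FOLPb

open Formula

/-- A numbering of the justification terms. -/
def JTerm.code : JTerm → ℕ
  | .var i => Nat.pair 0 i
  | .const i => Nat.pair 1 i
  | .app t s => Nat.pair 2 (Nat.pair t.code s.code)
  | .sum t s => Nat.pair 3 (Nat.pair t.code s.code)
  | .bang t => Nat.pair 4 t.code
  | .b t => Nat.pair 5 t.code
  | .gen x t => Nat.pair 6 (Nat.pair x t.code)

theorem JTerm.code_injective : Function.Injective JTerm.code := by
  intro t
  induction t with
  | var i => intro s h; cases s <;> simp_all [code, Nat.pair_eq_pair]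
  | const i => intro s h; cases s <;> simp_all [code, Nat.pair_eq_pair]
  | app t₁ t₂ ih₁ ih₂ =>
    intro s h
    cases s <;> simp [code, Nat.pair_eq_pair] at h
    rw [ih₁ h.1, ih₂ h.2]
  | sum t₁ t₂ ih₁ ih₂ =>
    intro s h
    cases s <;> simp [code, Nat.pair_eq_pair] at h
    rw [ih₁ h.1, ih₂ h.2]
  | bang t ih =>
    intro s h
    cases s <;> simp [code, Nat.pair_eq_pair] at h
    rw [ih h]
  | b t ih =>
    intro s h
    cases s <;> simp [code, Nat.pair_eq_pair] at h
    rw [ih h]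
  | gen x t ih =>
    intro s h
    cases s <;> simp [code, Nat.pair_eq_pair] at h
    rw [h.1, ih h.2]

namespace Formula

variable {D : Type}

/-- A numbering of the formulas. -/
def code [Encodable D] : Formula D → ℕ
  | rel n P args => Nat.pair 0 (Encodable.encode
      (⟨n, P, args⟩ : Σ n : ℕ, ℕ × (Fin n → ℕ ⊕ D)))
  | bot => Nat.pair 1 0
  | imp φ ψ => Nat.pair 2 (Nat.pair φ.code ψ.code)
  | all x φ => Nat.pair 3 (Nat.pair x φ.code)
  | just t X φ => Nat.pair 4 (Nat.pair t.code (Nat.pair (Encodable.encode X) φ.code))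

theorem code_injective [Encodable D] : Function.Injective (code : Formula D → ℕ) := by
  intro φ
  induction φ with
  | rel n P args =>
    intro ψ h
    cases ψ <;> simp [code, Nat.pair_eq_pair] at h
    obtain ⟨rfl, h⟩ := h
    simp_all
  | bot => intro ψ h; cases ψ <;> simp_all [code, Nat.pair_eq_pair]
  | imp φ₁ φ₂ ih₁ ih₂ =>
    intro ψ h
    cases ψ <;> simp [code, Nat.pair_eq_pair] at h
    rw [ih₁ h.1, ih₂ h.2]
  | all x φ ih =>
    intro ψ h
    cases ψ <;> simp [code, Nat.pair_eq_pair] at h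
    rw [h.1, ih h.2]
  | just t X φ ih =>
    intro ψ h
    cases ψ <;> simp [code, Nat.pair_eq_pair] at h
    rw [JTerm.code_injective h.1, h.2.1, ih h.2.2]

instance [Countable D] : Countable (Formula D) :=
  let ⟨_⟩ := nonempty_encodable D
  code_injective.countable

end Formula

/-! ### Truth clauses -/

namespace FittingModel

variable (M : FittingModel) (w : M.W)

theorem sat_rel (n P : ℕ) (args : Fin n → ℕ ⊕ M.D) : M.Sat w (rel n P args) ↔
    ∃ a : Fin n → M.D, (∀ i, args i = Sum.inr (a i)) ∧ a ∈ M.I n P w := by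
  rw [Sat]

theorem sat_bot : ¬ M.Sat w bot := by
  rw [Sat]
  exact id

theorem sat_imp (φ ψ : Formula M.D) : M.Sat w (imp φ ψ) ↔ (M.Sat w φ → M.Sat w ψ) := by
  rw [Sat]

theorem sat_all (x : ℕ) (φ : Formula M.D) :
    M.Sat w (all x φ) ↔ ∀ a, M.Sat w (φ.inst x a) := by
  rw [Sat]

theorem sat_just (t : JTerm) (X : Finset (ℕ ⊕ M.D)) (φ : Formula M.D) :
    M.Sat w (just t X φ) ↔ w ∈ M.Ev t φ ∧
      ∀ w' : M.W, M.R w w' → ∀ v : ℕ → M.D, M.Sat w' (φ.instAll v) := by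
  rw [Sat]

end FittingModel

/-! ### Construction of Henkin sets -/

variable {D : Type}

/-- Every formula `γ` that is consistent can be strengthened to a consistent formula that decides
`χ`, with a counterexample to `χ` if `χ` is a universal formula that is refuted. -/
theorem exists_consistent_decides [Infinite D] {CS : Set Fml} {γ : Formula D}
    (hγ : ¬ Provable (embed '' CS) (imp γ bot)) (χ : Formula D) :
    ∃ γ' : Formula D, ¬ Provable (embed '' CS) (imp γ' bot) ∧
      Provable (embed '' CS) (imp γ' γ) ∧
      (Provable (embed '' CS) (imp γ' χ) ∨ Provable (embed '' CS) (imp γ' (imp χ bot)) ∧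
        ∀ x φ, χ = all x φ → ∃ d, Provable (embed '' CS) (imp γ' (imp (φ.inst x d) bot))) := by
  by_cases h : Provable (embed '' CS) (imp (conj γ χ) bot)
  · have hχ := Provable.imp_not_of_conj h
    by_cases hall : ∃ x φ, χ = all x φ
    · obtain ⟨x, φ, rfl⟩ := hall
      obtain ⟨d, hd⟩ : ∃ d : D, Sum.inr d ∉ γ.individuals ∪ φ.individuals := by
        by_contra! hall
        exact Set.infinite_univ (((γ.finite_individuals.union φ.finite_individuals).preimage
          Sum.inr_injective.injOn).subset fun d _ => hall d)
      refine ⟨conj γ (imp (φ.inst x d) bot), fun h' => hγ ?_, Provable.conj_left _ _,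
        Or.inr ⟨Provable.imp_trans (Provable.conj_left _ _) hχ, fun y ψ hψ => ?_⟩⟩
      -- If adding ¬φ(d) were inconsistent, γ would imply φ(d), hence ∀xφ because d is new, while γ
      -- also refutes ∀xφ.
      · exact Provable.imp_mp hχ (Provable.imp_all_of_inst (fun h => hd (Or.inl h))
          (fun h => hd (Or.inr h))
          (Provable.imp_of_imp_not_not (Provable.imp_not_of_conj h')))
      · cases hψ
        exact ⟨d, Provable.conj_right _ _⟩
    · exact ⟨γ, hγ, Provable.imp_refl γ, Or.inr ⟨hχ, fun x φ h => absurd ⟨x, φ, h⟩ hall⟩⟩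
  · exact ⟨conj γ χ, h, Provable.conj_left _ _, Or.inl (Provable.conj_right _ _)⟩

/-- Maximal consistent sets of formulas with a counterexample in `D` to each universal formula
that is not a member. -/
structure IsHenkinSet (CS : Set Fml) (w : Set (Formula D)) : Prop where
  of_provable : ∀ {φ}, Provable (embed '' CS) φ → φ ∈ w
  mp : ∀ {φ ψ}, imp φ ψ ∈ w → φ ∈ w → ψ ∈ w
  bot_notMem : bot ∉ w
  mem_or : ∀ φ, φ ∈ w ∨ imp φ bot ∈ w
  all_mem : ∀ {x φ}, (∀ a, φ.inst x a ∈ w) → all x φ ∈ w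

/-- Run through an enumeration of all formulas, deciding one at each stage. Each stage is a single
formula implying the earlier ones; the Henkin set collects the consequences of all stages, so no
derivation from infinitely many premises is needed. -/
theorem exists_isHenkinSet [Countable D] [Infinite D] {CS : Set Fml} {γ : Formula D}
    (hγ : ¬ Provable (embed '' CS) (imp γ bot)) : ∃ w, γ ∈ w ∧ IsHenkinSet CS w := by
  have : Nonempty (Formula D) := ⟨bot⟩
  obtain ⟨f, hf⟩ := exists_surjective_nat (Formula D)
  choose next hcons himp hdec using fun (γ : {γ : Formula D //
    ¬ Provable (embed '' CS) (imp γ bot)}) => exists_consistent_decides γ.2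
  let g : ℕ → {γ : Formula D // ¬ Provable (embed '' CS) (imp γ bot)} := fun n =>
    Nat.rec ⟨γ, hγ⟩ (fun n γ => ⟨next γ (f n), hcons γ (f n)⟩) n
  have hg : ∀ m n, m ≤ n → Provable (embed '' CS) (imp (g n).1 (g m).1) := by
    intro m n hmn
    induction hmn with
    | refl => exact Provable.imp_refl _
    | step _ ih => exact Provable.imp_trans (himp _ _) ih
  have hmono : ∀ {m n φ}, m ≤ n → Provable (embed '' CS) (imp (g m).1 φ) →
      Provable (embed '' CS) (imp (g n).1 φ) := fun hmn h => Provable.imp_trans (hg _ _ hmn) h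
  have hmp : ∀ {φ ψ : Formula D}, (∃ n, Provable (embed '' CS) (imp (g n).1 (imp φ ψ))) →
      (∃ n, Provable (embed '' CS) (imp (g n).1 φ)) →
      ∃ n, Provable (embed '' CS) (imp (g n).1 ψ) := fun ⟨m, hm⟩ ⟨n, hn⟩ =>
    ⟨max m n, Provable.imp_mp (hmono (le_max_left m n) hm) (hmono (le_max_right m n) hn)⟩
  have hbot : ¬ ∃ n, Provable (embed '' CS) (imp (g n).1 bot) := fun ⟨n, hn⟩ => (g n).2 hn
  refine ⟨{φ | ∃ n, Provable (embed '' CS) (imp (g n).1 φ)}, ⟨0, Provable.imp_refl γ⟩,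
    fun h => ⟨0, Provable.imp_of h _⟩, hmp, hbot, fun φ => ?_, fun {x φ} h => ?_⟩
  · obtain ⟨n, rfl⟩ := hf φ
    exact (hdec (g n) (f n)).imp (fun h => ⟨n + 1, h⟩) fun h => ⟨n + 1, h.1⟩
  · obtain ⟨n, hn⟩ := hf (all x φ)
    rcases hdec (g n) (f n) with h' | h'
    · exact ⟨n + 1, hn ▸ h'⟩
    · obtain ⟨d, hd⟩ := h'.2 x φ hn
      exact absurd (hmp ⟨n + 1, hd⟩ (h d)) hbot

/-! ### Closure properties of Henkin sets and change of subscripts -/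

namespace IsHenkinSet

variable {CS : Set Fml} {w : Set (Formula D)}

theorem mem_of_axiom (hw : IsHenkinSet CS w) {φ ψ : Formula D} (h : Axiom (imp φ ψ))
    (hφ : φ ∈ w) : ψ ∈ w :=
  hw.mp (hw.of_provable (.ax h)) hφ

theorem imp_mem_iff (hw : IsHenkinSet CS w) {φ ψ : Formula D} :
    imp φ ψ ∈ w ↔ (φ ∈ w → ψ ∈ w) := by
  refine ⟨hw.mp, fun h => ?_⟩
  rcases hw.mem_or φ with hφ | hφ
  · exact hw.mem_of_axiom (.a1K _ _) (h hφ)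
  · exact hw.mp (hw.of_provable (Provable.imp_imp_left (Provable.bot_imp ψ) φ)) hφ

theorem all_mem_iff (hw : IsHenkinSet CS w) {x : ℕ} {φ : Formula D} (hφ : φ.IsDFormula) :
    all x φ ∈ w ↔ ∀ a, φ.inst x a ∈ w :=
  ⟨fun h _ => hw.mem_of_axiom (.a1Inst _ _ _ hφ.freeFor_single) h, hw.all_mem⟩

open Classical in
theorem just_union_mem (hw : IsHenkinSet CS w) {t : JTerm} {X : Finset (ℕ ⊕ D)}
    {φ : Formula D} (h : just t X φ ∈ w) (Y : Finset (ℕ ⊕ D)) : just t (Y ∪ X) φ ∈ w := by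
  induction Y using Finset.induction_on with
  | empty => rwa [Finset.empty_union]
  | insert y Y _ ih =>
    rw [Finset.insert_union]
    by_cases hy : y ∈ Y ∪ X
    · rwa [Finset.insert_eq_of_mem hy]
    · exact hw.mem_of_axiom (.a3 _ _ _ _ hy) ih

open Classical in
-- A2 removes the members of Y one by one: any that is not already in the remaining subscript is not
-- free in φ.
theorem just_mem_of_union (hw : IsHenkinSet CS w) {t : JTerm} {X Y : Finset (ℕ ⊕ D)}
    {φ : Formula D} (h : just t (Y ∪ X) φ ∈ w) (hY : ∀ y ∈ Y, y ∈ φ.fv → y ∈ X) :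
    just t X φ ∈ w := by
  induction Y using Finset.induction_on with
  | empty => rwa [Finset.empty_union] at h
  | insert y Y _ ih =>
    rw [Finset.insert_union] at h
    refine ih ?_ fun z hz => hY z (Finset.mem_insert_of_mem hz)
    by_cases hy : y ∈ Y ∪ X
    · rwa [Finset.insert_eq_of_mem hy] at h
    · exact hw.mem_of_axiom (.a2 _ _ _ _ hy fun hy' =>
        hy (Finset.mem_union_right _ (hY y (Finset.mem_insert_self _ _) hy'))) h

end IsHenkinSet

/-- `φ` is a member of `w` with justification `t`, where the subscript of `t` consists of elements
of the domain. -/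
def HasEvidence (w : Set (Formula D)) (t : JTerm) (φ : Formula D) : Prop :=
  ∃ X : Finset (ℕ ⊕ D), (∀ x, Sum.inl x ∉ X) ∧ just t X φ ∈ w

/-! ### Canonical evidence, the one-world model and its truth lemma -/

namespace IsHenkinSet

variable {CS : Set Fml} {w : Set (Formula D)}

theorem just_mem_of_hasEvidence (hw : IsHenkinSet CS w) {t : JTerm} {X : Finset (ℕ ⊕ D)}
    {φ : Formula D} (h : HasEvidence w t φ) (hX : ∀ d, Sum.inr d ∈ φ.fv → Sum.inr d ∈ X) :
    just t X φ ∈ w := by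
  classical
  obtain ⟨Y, hY, h⟩ := h
  have := hw.just_union_mem h X
  rw [Finset.union_comm] at this
  refine hw.just_mem_of_union this fun y hy hyφ => ?_
  rcases y with x | d
  · exact absurd hy (hY x)
  · exact hX d hyφ

theorem hasEvidence_app (hw : IsHenkinSet CS w) {t s : JTerm} {φ ψ : Formula D}
    (h₁ : HasEvidence w t (imp φ ψ)) (h₂ : HasEvidence w s φ) :
    HasEvidence w (.app t s) ψ := by
  classical
  obtain ⟨X, hX, h₁⟩ := h₁
  obtain ⟨Y, hY, h₂⟩ := h₂
  have h₁ := hw.just_union_mem h₁ Y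
  have h₂ := hw.just_union_mem h₂ X
  rw [Finset.union_comm] at h₂
  refine ⟨Y ∪ X, fun x hx => ?_, hw.mp (hw.mem_of_axiom (.b2 _ _ _ _ _) h₁) h₂⟩
  exact (Finset.mem_union.1 hx).elim (hY x) (hX x)

/-- As x is not in the subscript Y, A3 can be generalized to t:_Y φ → ∀x t:_{Yx} φ. With x in the
subscript, instantiating x by a also acts inside φ. -/
theorem hasEvidence_inst (hw : IsHenkinSet CS w) {t : JTerm} {φ : Formula D}
    (h : HasEvidence w t φ) (hφ : φ.IsDFormula) (x : ℕ) (a : D) :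
    HasEvidence w t (φ.inst x a) := by
  classical
  obtain ⟨X, hX, h⟩ := h
  -- With a in the subscript, a is free for x even if it already occurs in φ.
  have h₁ := hw.just_union_mem h {Sum.inr a}
  set Y : Finset (ℕ ⊕ D) := {Sum.inr a} ∪ X with hYdef
  have hY : ∀ y, Sum.inl y ∉ Y := by simpa [hYdef] using hX
  have h₂ : all x (just t (insert (Sum.inl x) Y) φ) ∈ w :=
    hw.mp (hw.of_provable (Provable.imp_all (γ := just t Y φ) (hY x)
      (.ax (.a3 _ _ _ _ (hY x))))) h₁
  have h₃ := hw.mem_of_axiom (.a1Inst x (Sum.inr a) _ (freeFor_single_just_iff.2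
    (Or.inr ⟨hφ.freeFor_single, fun _ => by simp [hYdef]⟩))) h₂
  rw [subst_single_just_of_mem _ _ _ (Finset.mem_insert_self _ _)] at h₃
  refine ⟨_, fun y hy => ?_, h₃⟩
  obtain ⟨u, hu, huy⟩ := Finset.mem_image.1 hy
  by_cases hux : u = Sum.inl x
  · rw [hux, single_self] at huy
    exact Sum.inr_ne_inl huy
  · rw [single_of_ne hux] at huy
    rw [huy] at hu hux
    exact (Finset.mem_insert.1 hu).elim hux (hY y)

/-- Take for X the domain elements free in φ. The evidence for φ(a) can be given the subscript Xa,
so all instances of ∀y t:_{Xy} φ belong to w; the Henkin property supplies the universal formula and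
Bb applies. -/
theorem hasEvidence_b (hw : IsHenkinSet CS w) {t : JTerm} {φ : Formula D} {y : ℕ}
    (h : ∀ a, HasEvidence w t (φ.inst y a)) : HasEvidence w (.b t) (all y φ) := by
  classical
  let X : Finset (ℕ ⊕ D) := φ.finite_fv.toFinset.filter fun u => u.isRight
  have hX : ∀ x, Sum.inl x ∉ X := fun x => by simp [X]
  refine ⟨X, hX, hw.mem_of_axiom (.bb t X y φ (hX y)) (hw.all_mem fun a => ?_)⟩
  rw [Formula.inst, subst_single_just_of_mem _ _ _ (Finset.mem_insert_self _ _)]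
  refine hw.just_mem_of_hasEvidence (h a) fun d hd => Finset.mem_image.2 ?_
  rcases mem_fv_subst_single hd with h' | h'
  · exact ⟨Sum.inr d, Finset.mem_insert_of_mem (by simpa [X] using h'.1), single_of_ne (by simp)⟩
  · exact ⟨_, Finset.mem_insert_self _ _, by rw [single_self, h'.1]⟩

theorem instAll_mem (hw : IsHenkinSet CS w) {t : JTerm} {φ : Formula D}
    (h : HasEvidence w t φ) (hφ : φ.IsDFormula) (v : ℕ → D) : φ.instAll v ∈ w := by
  obtain ⟨⟨X, _, h⟩, _⟩ := (instAll_induction v (P := fun φ => HasEvidence w t φ ∧ φ.IsDFormula)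
    (fun φ x h => ⟨hw.hasEvidence_inst h.1 h.2 x (v x), h.2.inst⟩) ⟨h, hφ⟩).1
  exact hw.mem_of_axiom (.b1 _ _ _) h

/-- The model whose only world is a given Henkin set. -/
def model [Nonempty D] (hw : IsHenkinSet CS w) : FittingModel where
  W := Unit
  D := D
  nonemptyW := inferInstance
  nonemptyD := inferInstance
  R _ _ := True
  I n P _ := {a | rel n P (fun i => Sum.inr (a i)) ∈ w}
  Ev t φ := {_u | HasEvidence w t φ}
  app_cond _ _ _ _ _ _ := fun _ h => hw.hasEvidence_app h.1 h.2
  sum_cond s t φ _ := by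
    rintro _ (⟨X, hX, h⟩ | ⟨X, hX, h⟩)
    · exact ⟨X, hX, hw.mem_of_axiom (.b3Left _ _ _ _) h⟩
    · exact ⟨X, hX, hw.mem_of_axiom (.b3Right _ _ _ _) h⟩
  bang_cond t φ X _ hX := fun _ h =>
    ⟨X.map Function.Embedding.inr, by simp, hw.mem_of_axiom (.b4 _ _ _)
      (hw.just_mem_of_hasEvidence h (by simpa using hX))⟩
  closure_cond _ _ _ _ _ h _ := h
  inst_cond _ _ x a hφ := fun _ h => hw.hasEvidence_inst h hφ x a
  -- Subscripts of evidence contain no variables, so the side condition of B5 holds for every x.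
  gen_cond _ _ x _ := fun _ ⟨X, hX, h⟩ => ⟨X, hX, hw.mem_of_axiom (.b5 _ _ x _ (hX x)) h⟩
  b_cond _ _ _ _ _ h := hw.hasEvidence_b h

theorem model_isFOLPb [Nonempty D] (hw : IsHenkinSet CS w) : hw.model.IsFOLPb :=
  ⟨fun _ => trivial, fun _ _ _ _ _ => trivial⟩

theorem model_meets [Nonempty D] (hw : IsHenkinSet CS w) : hw.model.Meets CS := by
  intro c φ h
  refine Set.eq_univ_of_forall fun _ => ⟨∅, by simp, hw.of_provable (.cs ?_)⟩
  exact ⟨_, h, embed_just_empty _ φ⟩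

/-- The induction is on the degree, since the clauses for ∀ and t:_X pass to substitution instances,
which are not subformulas. -/
theorem model_sat_iff [Nonempty D] (hw : IsHenkinSet CS w) (u : hw.model.W) (φ : Formula D)
    (hc : φ.Closed) (hd : φ.IsDFormula) : hw.model.Sat u φ ↔ φ ∈ w := by
  induction hn : φ.degree using Nat.strong_induction_on generalizing φ with
  | _ n ih =>
  subst hn
  rcases φ with ⟨n, P, args⟩ | _ | ⟨φ, ψ⟩ | ⟨x, φ⟩ | ⟨t, X, φ⟩
  · refine (FittingModel.sat_rel hw.model u n P args).trans ⟨?_, fun h => ?_⟩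
    · rintro ⟨a, ha, h⟩
      rwa [funext ha]
    · have : ∀ i, ∃ a, args i = Sum.inr a := fun i => by
        rcases hi : args i with x | a
        · exact absurd ⟨i, hi⟩ (hc x)
        · exact ⟨a, rfl⟩
      choose a ha using this
      rw [funext ha] at h
      exact ⟨a, ha, h⟩
  · exact iff_of_false (FittingModel.sat_bot hw.model u) hw.bot_notMem
  · simp only [degree] at ih
    exact (FittingModel.sat_imp hw.model u φ ψ).trans ((imp_congr
      (ih _ (by omega) φ (fun x hx => hc x (Or.inl hx)) hd.1 rfl)
      (ih _ (by omega) ψ (fun x hx => hc x (Or.inr hx)) hd.2 rfl)).trans hw.imp_mem_iff.symm)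
  · simp only [degree] at ih
    refine (FittingModel.sat_all hw.model u x φ).trans ((forall_congr' fun a => ?_).trans
      (hw.all_mem_iff (φ := φ) hd).symm)
    exact ih φ.degree (by omega) _ hc.inst (IsDFormula.inst hd) (degree_subst _ _)
  · simp only [degree] at ih
    -- Evidence alone yields membership; conversely membership yields evidence, and through B1 the
    -- truth of all instances.
    refine (FittingModel.sat_just hw.model u t X φ).trans
      ⟨fun h => hw.just_mem_of_hasEvidence h.1 hd.2, fun h => ?_⟩
    have hev : HasEvidence w t φ := ⟨X, hc, h⟩
    refine ⟨hev, fun u' _ v => ?_⟩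
    obtain ⟨hd', hc'⟩ := instAll_induction v (fun φ x h => IsDFormula.inst h) hd.1
    exact (ih φ.degree (by omega) _ hc' hd' (degree_subst _ _)).2 (hw.instAll_mem hev hd.1 v)

end IsHenkinSet

end FOLPb

/-- Completeness. The countermodel has a single world, so the evidence function alone separates
justified from unjustified formulas; constants need not be supplied for any axiom, and the
hypotheses on `CS` are not used. -/
theorem mainTheorem1 (CS : Set FOLPb.Fml) (hCS : FOLPb.IsConstantSpecification CS)
    (hvariant : FOLPb.VariantClosed CS) (happ : FOLPb.AxiomaticallyAppropriate CS)
    (φ : FOLPb.Fml) (hclosed : φ.Closed) (hvalid : FOLPb.Valid CS φ) :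
    FOLPb.Provable CS φ := by
  by_contra h
  -- The domain must be infinite, to supply new witnesses, and countable, so that formulas can be
  -- enumerated and its elements traded for variables.
  obtain ⟨w, hφ, hw⟩ := FOLPb.exists_isHenkinSet (D := ℕ) (CS := CS)
    (γ := .imp φ.embed .bot)
    fun h' => h (FOLPb.Provable.of_embed (.mp (.ax (.a1N _)) h'))
  exact hw.bot_notMem (hw.mp hφ ((hw.model_sat_iff () φ.embed hclosed.embed
    (FOLPb.Formula.isDFormula_embed φ)).1 (hvalid hw.model hw.model_isFOLPb hw.model_meets ())))
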